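/- **Setting.** Let $\mathcal X$ be a set of examples, $\mathcal Y$ a finite set of labels, and $\Phi$ a set of predicates on $\mathcal X$ (features) that is closed under negation. A representation of size $m\ge 1$ consists of sets $G_1,\dots,G_m$ covering $\mathcal X$, for each $x$ a choice $G(x)$ of one of these sets that contains $x$, labels $\ell(G_i)\in\mathcal Y$, and, for all $i,j$ with $\ell(G_i)\ne\ell(G_j)$, a feature $\phi(G_i,G_j)\in\Phi$ that is true on all of $G_i$ and false on all of $G_j$, with $\phi(G_j,G_i)=\neg\phi(G_i,G_j)$. It has unique labels if $\ell(G_1),\dots,\ell(G_m)$ are pairwise distinct. **Protocol.** A first labeled example $(x_0,y_0)$ is given. In round $t=1,2,\dots$ an example $x_t$ arrives, the learner outputs a prediction $\hat y_t$ and an explanation $\hat x_t$, and the teacher has a label $y_t$ and a feature $\phi_t$; these are revealed to the learner only if $\hat y_t\ne y_t$ (a mistake). The source of the $x_t,y_t,\phi_t$ is an arbitrary adaptive adversary: $x_t$ may depend on everything that happened before round $t$, and $y_t,\phi_t$ also on $\hat y_t,\hat x_t$. Round $t\ge1$ is an exception with respect to a representation if $y_t\ne\ell(G(x_t))$, or if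 $\hat y_t\neq y_t$, $\ell(G(x_t))\ne\ell(G(\hat x_t))$ and $\phi_t\ne\phi(G(x_t),G(\hat x_t))$. The initial example is an exception if $y_0\ne\ell(G(x_0))$. **Algorithm** (parameters $m$, $l\in\mathbb N$, $p\in[0,1]$). Maintain a list $L$ of rules, initially empty; a rule $C[\hat x]$ has a representing example $\hat x$, a label, a conjunction of literals, and an update counter $U(\hat x)$. On $x_t$: * If some rule $C[\hat x]\in L$ is satisfied by $x_t$, predict its label and explain by $\hat x$. If the prediction is wrong: if $\hat x$ satisfies $\neg\phi_t$ and $x_t$ satisfies $\phi_t$, add $\neg\phi_t$ to the conjunction $C[\hat x]$; in any case increase $U(\hat x)$ by $1$, and delete the rule if $U(\hat x)\ge m+l-1$. * If no rule is satisfied by $x_t$, predict $y_0$ and explain by $x_0$. If the prediction is wrong and $L$ has no rule with label $y_t$, draw an independent bit that is $1$ with probability $p$, and if it is $1$ add to $L$ a rule $C[x_t]$ with label $y_t$, empty conjunction and $U(x_t)=0$. If the prediction is wrong and $L$ has a rule $C[\hat x]$ with label $y_t$, remove from its conjunction some literal not satisfied by $x_t$, increase $U(\hat x)$ by $1$, and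 delete the rule if $U(\hat x)\ge m+l-1$. Which satisfied rule is used and which unsatisfied literal is removed is arbitrary (it may depend on the past). **Theorem.** Run the algorithm with $l=m-1$ and with $p=1/(m-1)$ (and $p=1$ if $m=1$). Suppose that there is a representation of size $m$ with unique labels such that, almost surely, at most $k$ exceptions with respect to it occur in the interaction. Then the expected total number of mistakes of the algorithm is at most $2m(m-1)+6k$. -/

import Mathlib

open MeasureTheory ProbabilityTheory
open scoped ENNReal

namespace DFF

/-- A binary feature: a predicate on the domain of examples. -/
abbrev Feature (X : Type*) := X → Bool

/-- The negation of a feature. -/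
def neg {X : Type*} (φ : Feature X) : Feature X := fun x => !φ x

/-- A component representation of size `m` over the feature class `Φ`: components `G i` that cover
the domain, a choice `comp x` of a component containing `x`, a label for each component, and a
choice `disc i j` of a feature discriminating `G i` from `G j` whenever their labels differ
(`disc i j` carries no information when the labels agree). -/
structure Representation (X Y : Type*) (Φ : Set (Feature X)) (m : ℕ) where
  G : Fin m → Set X
  comp : X → Fin m
  mem_comp : ∀ x, x ∈ G (comp x)
  label : Fin m → Y
  disc : Fin m → Fin m → Feature X
  disc_mem : ∀ i j, label i ≠ label j → disc i j ∈ Φ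
  disc_true : ∀ i j, label i ≠ label j → ∀ x ∈ G i, disc i j x = true
  disc_false : ∀ i j, label i ≠ label j → ∀ x ∈ G j, disc i j x = false
  disc_symm : ∀ i j, label i ≠ label j → disc j i = neg (disc i j)

/-- The concept induced by a representation. -/
def Representation.target {X Y : Type*} {Φ : Set (Feature X)} {m : ℕ}
    (R : Representation X Y Φ m) (x : X) : Y := R.label (R.comp x)

/-- Each component has a label of its own. -/
def Representation.UniqueLabels {X Y : Type*} {Φ : Set (Feature X)} {m : ℕ}
    (R : Representation X Y Φ m) : Prop := Function.Injective R.label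

/-- A rule `C[rep]`: its representing example, its conjunction of literals, and the number of
updates applied to it so far. -/
structure Rule (X : Type*) where
  rep : X
  conj : Finset (Feature X)
  updates : ℕ

/-- The example `x` satisfies the conjunction of the rule. -/
def Rule.Sat {X : Type*} (r : Rule X) (x : X) : Prop := ∀ φ ∈ r.conj, φ x = true

/-- The current collection of rules, indexed by their labels. The algorithm creates a rule only if
no rule with that label is present, so there is never more than one rule per label. -/
abbrev Rules (X Y : Type*) := Y → Option (Rule X)

/-- The record of one round: the example, the prediction, the explanation, the label and the feature
of the teacher (used by the learner only if the prediction is incorrect), and the random bit drawn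
by the learner (used only if the learner attempts to create a rule). -/
structure Round (X Y : Type*) where
  x : X
  pred : Y
  expl : X
  y : Y
  feature : Feature X
  coin : Bool

/-- Completed rounds, most recent first. -/
abbrev History (X Y : Type*) := List (Round X Y)

/-- The prediction in a round is incorrect. -/
def Round.IsMistake {X Y : Type*} (ρ : Round X Y) : Prop := ρ.pred ≠ ρ.y

/-- A round is an exception if its label is inconsistent with the representation, or if a
discriminative feature was requested and the feature provided is not the one prescribed by the
representation. (If the components of the example and of the explanation have the same label,
nothing is prescribed, and any feature is accepted.) -/
def Round.IsException {X Y : Type*} {Φ : Set (Feature X)} {m : ℕ}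
    (R : Representation X Y Φ m) (ρ : Round X Y) : Prop :=
  ρ.y ≠ R.target ρ.x ∨
    (ρ.IsMistake ∧ R.label (R.comp ρ.x) ≠ R.label (R.comp ρ.expl) ∧
      ρ.feature ≠ R.disc (R.comp ρ.x) (R.comp ρ.expl))

/-- An adversarial source of labeled examples and feature feedback. The first labeled example is
`(x₀, y₀)`; then the next example may depend on all completed rounds (including the random bits
drawn in them), and its label and the discriminative feature may in addition depend on the
prediction and the explanation of the learner. A fixed stream of examples is the special case in
which `nextExample` and `label` depend only on the number of completed rounds. -/
structure Environment (X Y : Type*) where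
  x₀ : X
  y₀ : Y
  nextExample : History X Y → X
  label : History X Y → Y → X → Y
  feature : History X Y → Y → X → Feature X

/-- The choices that the algorithm leaves open: which satisfied rule is used for the prediction
(identified by its label), and which violated literal is removed from a conjunction. Both may depend
on the past in an arbitrary way. -/
structure Choices (X Y : Type*) where
  rule : History X Y → Rules X Y → X → Y
  rule_spec : ∀ (h : History X Y) (L : Rules X Y) (x : X), (∃ y r, L y = some r ∧ r.Sat x) →
    ∃ r, L (rule h L x) = some r ∧ r.Sat x
  literal : History X Y → Rule X → X → Feature X
  literal_spec : ∀ (h : History X Y) (r : Rule X) (x : X), ¬ r.Sat x →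
    literal h r x ∈ r.conj ∧ literal h r x x = false

open Classical in
/-- The rule used for predicting on `x`, with its label; `none` if no rule is satisfied by `x`. -/
noncomputable def matchedRule {X Y : Type*} (ch : Choices X Y) (h : History X Y) (L : Rules X Y)
    (x : X) : Option (Y × Rule X) :=
  if ∃ y r, L y = some r ∧ r.Sat x then
    (L (ch.rule h L x)).map (fun r => (ch.rule h L x, r))
  else none

/-- The prediction and the explanation on `x`: the label and the representing example of the matched
rule, or `(y₀, x₀)` if there is none. -/
noncomputable def predict {X Y : Type*} (ch : Choices X Y) (x₀ : X) (y₀ : Y) (h : History X Y)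
    (L : Rules X Y) (x : X) : Y × X :=
  match matchedRule ch h L x with
  | some (y, r) => (y, r.rep)
  | none => (y₀, x₀)

/-- Increment the update counter of a rule, and delete the rule if the counter reaches `limit`. -/
def countUpdate {X : Type*} (limit : ℕ) (r : Rule X) : Option (Rule X) :=
  if limit ≤ r.updates + 1 then none else some { r with updates := r.updates + 1 }

open Classical in
/-- The modification of the rules after an incorrect prediction on `x`, given the correct label `y`,
the feature `φ` and the random bit `b`. -/
noncomputable def updateRules {X Y : Type*} (m l : ℕ) (ch : Choices X Y) (h : History X Y)
    (L : Rules X Y) (x : X) (y : Y) (φ : Feature X) (b : Bool) : Rules X Y :=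
  match matchedRule ch h L x with
  | some (z, r) =>
      Function.update L z (countUpdate (m + l - 1)
        (if neg φ r.rep = true ∧ φ x = true then { r with conj := insert (neg φ) r.conj } else r))
  | none =>
      match L y with
      | none => if b = true then Function.update L y (some ⟨x, ∅, 0⟩) else L
      | some r =>
          Function.update L y (countUpdate (m + l - 1)
            { r with conj := r.conj.erase (ch.literal h r x) })

/-- The completed rounds and the current rules. -/
structure State (X Y : Type*) where
  history : History X Y
  rules : Rules X Y

/-- The round played from state `s` with random bit `b`. -/
noncomputable def playRound {X Y : Type*} (env : Environment X Y) (ch : Choices X Y)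
    (s : State X Y) (b : Bool) : Round X Y :=
  let x := env.nextExample s.history
  let a := predict ch env.x₀ env.y₀ s.history s.rules x
  ⟨x, a.1, a.2, env.label s.history a.1 a.2, env.feature s.history a.1 a.2, b⟩

open Classical in
/-- One iteration of the algorithm. -/
noncomputable def step {X Y : Type*} (m l : ℕ) (env : Environment X Y) (ch : Choices X Y)
    (s : State X Y) (b : Bool) : State X Y :=
  let ρ := playRound env ch s b
  { history := ρ :: s.history
    rules :=
      if ρ.IsMistake then updateRules m l ch s.history s.rules ρ.x ρ.y ρ.feature b else s.rules }

/-- The state after `t` rounds when the random bits are `c 0, c 1, …`; initially there are no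
rules. -/
noncomputable def run {X Y : Type*} (m l : ℕ) (env : Environment X Y) (ch : Choices X Y)
    (c : ℕ → Bool) : ℕ → State X Y
  | 0 => ⟨[], fun _ => none⟩
  | t + 1 => step m l env ch (run m l env ch c t) (c t)

/-- The `t`-th round of the run (counting from zero, after the initial example `x₀`). -/
noncomputable def roundAt {X Y : Type*} (m l : ℕ) (env : Environment X Y) (ch : Choices X Y)
    (c : ℕ → Bool) (t : ℕ) : Round X Y :=
  playRound env ch (run m l env ch c t) (c t)

open Classical in
/-- The total number of mistakes of the run. -/
noncomputable def numMistakes {X Y : Type*} (m l : ℕ) (env : Environment X Y) (ch : Choices X Y)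
    (c : ℕ → Bool) : ℝ≥0∞ :=
  ∑' t, if (roundAt m l env ch c t).IsMistake then 1 else 0

open Classical in
/-- The total number of exceptions of the run with respect to a representation, including the
initial example `x₀` if its label is inconsistent with the representation. -/
noncomputable def numExceptions {X Y : Type*} {Φ : Set (Feature X)} {m' : ℕ}
    (R : Representation X Y Φ m') (m l : ℕ) (env : Environment X Y) (ch : Choices X Y)
    (c : ℕ → Bool) : ℝ≥0∞ :=
  (if env.y₀ ≠ R.target env.x₀ then 1 else 0) +
    ∑' t, if (roundAt m l env ch c t).IsException R then 1 else 0

end DFF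

/-! The proof is a potential argument. A rule is correct if its label is the concept's label of its
representing example. A round without an exception removes an error from the conjunction of every
correct rule that it touches, and a correct rule has at most `m - 1` errors when it is created, so
it makes at most `m - 1` mistakes unless there are exceptions, each of which costs a bounded number
of further mistakes. A rule that is not correct was created in an exceptional round and is deleted
after `2 (m - 1)` mistakes, but for this it must be drawn, which happens with probability
`1 / (m - 1)` only: an exception that attempts to create it costs `2` mistakes on average. A label
without a rule costs `m - 1` mistakes on average until its rule is created, and then `m - 1` more.
The potential is the sum over the labels of these costs; in every round, its expected decrease plus
six times the number of exceptions is at least the number of mistakes. -/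

namespace DFF

open scoped symmDiff

section SymmDiff

variable {α : Type*} [DecidableEq α] {s t : Finset α} {a : α}

theorem card_insert_symmDiff_lt (hs : a ∉ s) (ht : a ∈ t) :
    (insert a s ∆ t).card < (s ∆ t).card := by
  have h : insert a s ∆ t = (s ∆ t).erase a := by grind [Finset.mem_symmDiff]
  rw [h]
  exact Finset.card_erase_lt_of_mem (by simp [Finset.mem_symmDiff, hs, ht])

theorem card_erase_symmDiff_lt (hs : a ∈ s) (ht : a ∉ t) :
    (s.erase a ∆ t).card < (s ∆ t).card := by
  have h : s.erase a ∆ t = (s ∆ t).erase a := by grind [Finset.mem_symmDiff]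
  rw [h]
  exact Finset.card_erase_lt_of_mem (by simp [Finset.mem_symmDiff, hs, ht])

theorem card_insert_symmDiff_le (s t : Finset α) (a : α) :
    (insert a s ∆ t).card ≤ (s ∆ t).card + 1 := by
  have h : insert a s ∆ t ⊆ insert a (s ∆ t) := by grind [Finset.mem_symmDiff]
  exact (Finset.card_le_card h).trans (Finset.card_insert_le _ _)

theorem card_erase_symmDiff_le (s t : Finset α) (a : α) :
    (s.erase a ∆ t).card ≤ (s ∆ t).card + 1 := by
  have h : s.erase a ∆ t ⊆ insert a (s ∆ t) := by grind [Finset.mem_symmDiff]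
  exact (Finset.card_le_card h).trans (Finset.card_insert_le _ _)

end SymmDiff

section ENNReal

variable {ι : Type*}

theorem tsum_update_add_apply [DecidableEq ι] {β : Type*} (f : ι → β → ℝ≥0∞) (u : ι → β) (i : ι)
    (b : β) :
    ∑' j, f j (Function.update u i b j) + f i (u i) = ∑' j, f j (u j) + f i b := by
  rw [ENNReal.tsum_eq_add_tsum_ite i, ENNReal.tsum_eq_add_tsum_ite (f := fun j => f j (u j)) i,
    Function.update_self, add_right_comm, add_right_comm (f i (u i)), add_comm (f i b)]
  congr 1
  refine tsum_congr fun j => ?_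
  split_ifs with hj
  · rfl
  · rw [Function.update_of_ne hj]

theorem tsum_le_add_tsum_of_add_le_add {a b v : ℕ → ℝ≥0∞}
    (h : ∀ t, a t + v (t + 1) ≤ v t + b t) : ∑' t, a t ≤ v 0 + ∑' t, b t := by
  have hsum (T : ℕ) :
      ∑ t ∈ Finset.range T, a t + v T ≤ v 0 + ∑ t ∈ Finset.range T, b t := by
    induction T with
    | zero => simp
    | succ T ih =>
      calc ∑ t ∈ Finset.range (T + 1), a t + v (T + 1)
          = ∑ t ∈ Finset.range T, a t + (a T + v (T + 1)) := by
            rw [Finset.sum_range_succ, add_assoc]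
        _ ≤ ∑ t ∈ Finset.range T, a t + (v T + b T) := add_le_add_right (h T) _
        _ = ∑ t ∈ Finset.range T, a t + v T + b T := (add_assoc _ _ _).symm
        _ ≤ v 0 + ∑ t ∈ Finset.range T, b t + b T := by gcongr
        _ = v 0 + ∑ t ∈ Finset.range (T + 1), b t := by rw [Finset.sum_range_succ, add_assoc]
  refine ENNReal.tsum_le_of_sum_range_le fun T => ?_
  calc ∑ t ∈ Finset.range T, a t
      ≤ ∑ t ∈ Finset.range T, a t + v T := le_self_add
    _ ≤ v 0 + ∑ t ∈ Finset.range T, b t := hsum T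
    _ ≤ v 0 + ∑' t, b t := by
      gcongr
      exact ENNReal.sum_le_tsum _

theorem add_weighted_le {p a u v w : ℝ≥0∞} (hp : p ≤ 1) (hu : a + u ≤ w) (hv : a + v ≤ w) :
    a + (p * u + (1 - p) * v) ≤ w := by
  have h1 : p + (1 - p) = 1 := add_tsub_cancel_of_le hp
  calc a + (p * u + (1 - p) * v)
      = (p + (1 - p)) * a + (p * u + (1 - p) * v) := by rw [h1, one_mul]
    _ = p * (a + u) + (1 - p) * (a + v) := by ring
    _ ≤ p * w + (1 - p) * w := by gcongr
    _ = w := by rw [← add_mul, h1, one_mul]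

end ENNReal

section Independence

variable {Ω ι α β : Type*} [MeasurableSpace Ω] {μ : Measure Ω} [Countable α] [MeasurableSpace α]
  [MeasurableSingletonClass α] [MeasurableSpace β]

theorem lintegral_eq_tsum_of_indepFun [IsFiniteMeasure μ] {Z : Ω → α} {W : Ω → β}
    (hZ : Measurable Z) (hW : Measurable W) (h : IndepFun Z W μ) {F : α → β → ℝ≥0∞}
    (hF : ∀ a, Measurable (F a)) :
    ∫⁻ ω, F (Z ω) (W ω) ∂μ = ∑' a, μ (Z ⁻¹' {a}) * ∫⁻ ω, F a (W ω) ∂μ := by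
  have hF' : Measurable (Function.uncurry F) := measurable_from_prod_countable_right hF
  calc ∫⁻ ω, F (Z ω) (W ω) ∂μ
      = ∫⁻ z, Function.uncurry F z ∂(μ.map fun ω => (Z ω, W ω)) :=
        (lintegral_map hF' (hZ.prodMk hW)).symm
    _ = ∫⁻ a, ∫⁻ b, F a b ∂(μ.map W) ∂(μ.map Z) := by
        rw [h.map_prod_eq_prod_map_map hZ.aemeasurable hW.aemeasurable,
          lintegral_prod _ hF'.aemeasurable]
        rfl
    _ = ∑' a, μ (Z ⁻¹' {a}) * ∫⁻ ω, F a (W ω) ∂μ := by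
        rw [lintegral_countable']
        refine tsum_congr fun a => ?_
        rw [lintegral_map (hF a) hW, Measure.map_apply hZ (measurableSet_singleton a), mul_comm]

theorem measurable_of_dependsOn [Nonempty β] {s : Finset ι} {F : (ι → α) → β}
    (hF : DependsOn F s) : Measurable F := by
  obtain ⟨g, rfl⟩ := dependsOn_iff_exists_comp.1 hF
  exact (measurable_of_countable g).comp (measurable_pi_lambda _ fun i => measurable_pi_apply _)

theorem lintegral_eq_tsum_of_dependsOn [IsFiniteMeasure μ] {B : ι → Ω → α}
    (hB : ∀ i, Measurable (B i)) (hindep : iIndepFun B μ) {s : Finset ι} {i : ι} (hi : i ∉ s)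
    {F : α → (ι → α) → ℝ≥0∞} (hF : ∀ a, DependsOn (F a) s) :
    ∫⁻ ω, F (B i ω) (fun j => B j ω) ∂μ =
      ∑' a, μ (B i ⁻¹' {a}) * ∫⁻ ω, F a (fun j => B j ω) ∂μ := by
  choose g hg using fun a => dependsOn_iff_exists_comp.1 (hF a)
  have hind : IndepFun (B i) (fun ω (j : s) => B j ω) μ :=
    (hindep.indepFun_finset {i} s (by simpa using hi) hB).comp
      (measurable_pi_apply (⟨i, Finset.mem_singleton_self i⟩ : ({i} : Finset ι))) measurable_id
  simp only [hg]
  exact lintegral_eq_tsum_of_indepFun (W := fun ω (j : s) => B j ω) (F := g) (hB i)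
    (measurable_pi_lambda _ fun j => hB j) hind fun a => measurable_of_countable (g a)

end Independence

section Literals

variable {X Y : Type*} {Φ : Set (Feature X)} {m : ℕ}

theorem Representation.size_pos (R : Representation X Y Φ m) (x : X) : 0 < m :=
  Fin.pos (R.comp x)

open Classical in
/-- The features that discriminate the component `i` from the components with other labels: the
conjunction that a rule represented by an example of this component should have. -/
noncomputable def Representation.literals (R : Representation X Y Φ m) (i : Fin m) :
    Finset (Feature X) :=
  (Finset.univ.filter fun j => R.label i ≠ R.label j).image (R.disc i)

theorem Representation.card_literals_le (R : Representation X Y Φ m) (i : Fin m) :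
    (R.literals i).card ≤ m - 1 := by
  classical
  have h : (Finset.univ.filter fun j => R.label i ≠ R.label j) ⊆ Finset.univ.erase i := by grind
  exact Finset.card_image_le.trans (by simpa using Finset.card_le_card h)

theorem Representation.disc_mem_literals (R : Representation X Y Φ m) {i j : Fin m}
    (h : R.label i ≠ R.label j) : R.disc i j ∈ R.literals i := by
  simp only [literals, Finset.mem_image, Finset.mem_filter, Finset.mem_univ, true_and]
  exact ⟨j, h, rfl⟩

theorem Representation.eq_true_of_mem_literals (R : Representation X Y Φ m) {φ : Feature X} {x : X}
    (h : φ ∈ R.literals (R.comp x)) : φ x = true := by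
  simp only [literals, Finset.mem_image, Finset.mem_filter, Finset.mem_univ, true_and] at h
  obtain ⟨j, hj, rfl⟩ := h
  exact R.disc_true _ _ hj x (R.mem_comp x)

open Classical in
/-- The revision of a rule that made a mistake on `x`: the literal `neg φ` is added if it separates
the representing example from `x`. -/
noncomputable def Rule.specialize (r : Rule X) (φ : Feature X) (x : X) : Rule X :=
  if neg φ r.rep = true ∧ φ x = true then { r with conj := insert (neg φ) r.conj } else r

open Classical in
/-- The revision of a rule that should have been satisfied: the literal `φ` is removed. -/
noncomputable def Rule.generalize (r : Rule X) (φ : Feature X) : Rule X :=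
  { r with conj := r.conj.erase φ }

theorem Rule.rep_specialize (r : Rule X) (φ : Feature X) (x : X) :
    (r.specialize φ x).rep = r.rep := by
  unfold specialize
  split_ifs <;> rfl

theorem Rule.updates_specialize (r : Rule X) (φ : Feature X) (x : X) :
    (r.specialize φ x).updates = r.updates := by
  unfold specialize
  split_ifs <;> rfl

open Classical in
/-- The number of literals that are missing in the conjunction of a rule or that it should not
contain, judged by the component of its representing example. -/
noncomputable def Rule.numErrors (R : Representation X Y Φ m) (r : Rule X) : ℕ :=
  (r.conj ∆ R.literals (R.comp r.rep)).card

theorem Rule.numErrors_of_conj_eq_empty (R : Representation X Y Φ m) {r : Rule X}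
    (hr : r.conj = ∅) : r.numErrors R ≤ m - 1 := by
  classical
  rw [numErrors, hr, ← Finset.bot_eq_empty, bot_symmDiff]
  exact R.card_literals_le _

theorem Rule.numErrors_specialize_lt (R : Representation X Y Φ m) {r : Rule X} {x : X}
    (hx : r.Sat x) (hne : R.label (R.comp x) ≠ R.label (R.comp r.rep)) :
    (r.specialize (R.disc (R.comp x) (R.comp r.rep)) x).numErrors R < r.numErrors R := by
  classical
  have htrue : R.disc (R.comp x) (R.comp r.rep) x = true := R.disc_true _ _ hne x (R.mem_comp x)
  have hneg : neg (R.disc (R.comp x) (R.comp r.rep)) = R.disc (R.comp r.rep) (R.comp x) :=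
    (R.disc_symm _ _ hne).symm
  have hrep : R.disc (R.comp r.rep) (R.comp x) r.rep = true :=
    R.disc_true _ _ hne.symm r.rep (R.mem_comp r.rep)
  have hnotMem : R.disc (R.comp r.rep) (R.comp x) ∉ r.conj := fun hmem =>
    absurd (hx _ hmem) (by simp [R.disc_false _ _ hne.symm x (R.mem_comp x)])
  rw [specialize, hneg, if_pos ⟨hrep, htrue⟩]
  exact card_insert_symmDiff_lt hnotMem (R.disc_mem_literals hne.symm)

theorem Rule.numErrors_specialize_le (R : Representation X Y Φ m) (r : Rule X) (φ : Feature X)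
    (x : X) : (r.specialize φ x).numErrors R ≤ r.numErrors R + 1 := by
  classical
  unfold specialize
  split_ifs
  · exact card_insert_symmDiff_le _ _ _
  · exact Nat.le_succ _

theorem Rule.numErrors_generalize_lt (R : Representation X Y Φ m) {r : Rule X} {φ : Feature X}
    {x : X} (hφ : φ ∈ r.conj) (hx : φ x = false) (hcomp : R.comp r.rep = R.comp x) :
    (r.generalize φ).numErrors R < r.numErrors R := by
  classical
  refine card_erase_symmDiff_lt hφ fun hmem => ?_
  rw [generalize, hcomp] at hmem
  simp [R.eq_true_of_mem_literals hmem] at hx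

theorem Rule.numErrors_generalize_le (R : Representation X Y Φ m) (r : Rule X) (φ : Feature X) :
    (r.generalize φ).numErrors R ≤ r.numErrors R + 1 := by
  classical
  exact card_erase_symmDiff_le _ _ _

end Literals

section Potential

variable {X Y : Type*} {Φ : Set (Feature X)} {m : ℕ}

/-- The expected number of attempts until a rule is created; its inverse is the probability with
which the algorithm creates rules. The maximum accounts for `m = 1`, where every attempt
succeeds. -/
def waitingTime (m : ℕ) : ℕ := max (m - 1) 1

open Classical in
/-- The potential of a label without a rule. A label that is used by the representation, and that is
not predicted by default, waits for the creation of its rule, and this rule makes up to `m - 1`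
mistakes. -/
noncomputable def vacantPotential (R : Representation X Y Φ m) (y₀ y : Y) : ℕ :=
  if y ∈ Set.range R.label ∧ y ≠ y₀ then waitingTime m + (m - 1) else 0

open Classical in
/-- The potential of a rule with label `y`. If the label of the rule is correct, it has to correct
its errors, and the sum of errors and updates, which is constant as long as there are no exceptions,
exceeds `m - 1` by at most two for each exception. If the label is not correct, the rule makes
mistakes until it is deleted; then the label is vacant. -/
noncomputable def rulePotential (R : Representation X Y Φ m) (y₀ y : Y) (r : Rule X) : ℕ :=
  if R.target r.rep = y then r.numErrors R + 2 * (r.updates + r.numErrors R - (m - 1))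
  else vacantPotential R y₀ y + max (2 * (m - 1) - r.updates) 1

/-- The potential of a label with its rule, if there is one. -/
noncomputable def labelPotential (R : Representation X Y Φ m) (y₀ y : Y) : Option (Rule X) → ℕ
  | none => vacantPotential R y₀ y
  | some r => rulePotential R y₀ y r

/-- The potential of a collection of rules. -/
noncomputable def potential (R : Representation X Y Φ m) (y₀ : Y) (L : Rules X Y) : ℝ≥0∞ :=
  ∑' y, (labelPotential R y₀ y (L y) : ℝ≥0∞)

theorem waitingTime_pos (m : ℕ) : 0 < waitingTime m := by
  unfold waitingTime
  omega

theorem inv_waitingTime_le_one (m : ℕ) : (waitingTime m : ℝ≥0∞)⁻¹ ≤ 1 :=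
  ENNReal.inv_le_one.2 (by exact_mod_cast waitingTime_pos m)

theorem ofReal_creationProb (hm : 0 < m) :
    ENNReal.ofReal (if m = 1 then 1 else 1 / ((m : ℝ) - 1)) = (waitingTime m : ℝ≥0∞)⁻¹ := by
  split_ifs with h1
  · simp [waitingTime, h1]
  · have hw : waitingTime m = m - 1 := max_eq_left (by omega)
    have hcast : (m : ℝ) - 1 = (waitingTime m : ℕ) := by rw [hw, Nat.cast_pred hm]
    rw [hcast, one_div, ENNReal.ofReal_inv_of_pos (by exact_mod_cast waitingTime_pos m),
      ENNReal.ofReal_natCast]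

theorem vacantPotential_le (R : Representation X Y Φ m) (y₀ y : Y) :
    vacantPotential R y₀ y ≤ waitingTime m + (m - 1) := by
  unfold vacantPotential
  split_ifs <;> simp

theorem labelPotential_countUpdate_lt (R : Representation X Y Φ m) (y₀ y : Y) {r r' : Rule X}
    (hrep : r'.rep = r.rep) (hupdates : r'.updates = r.updates)
    (herrors : R.target r.rep = y → r'.numErrors R < r.numErrors R) :
    labelPotential R y₀ y (countUpdate (m + (m - 1) - 1) r') < labelPotential R y₀ y (some r) := by
  have hvacant := vacantPotential_le R y₀ y
  have hcount (n : ℕ) : Rule.numErrors R { r' with updates := n } = r'.numErrors R := rfl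
  unfold waitingTime at hvacant
  unfold countUpdate
  by_cases hy : R.target r.rep = y
  · have := herrors hy
    split_ifs <;> simp only [labelPotential, rulePotential, hcount] <;>
      simp only [hrep, hy, if_true] <;> omega
  · split_ifs <;> simp only [labelPotential, rulePotential, hrep, hy, if_false] <;> omega

theorem labelPotential_countUpdate_le (R : Representation X Y Φ m) (y₀ y : Y) {r r' : Rule X}
    (hrep : r'.rep = r.rep) (hupdates : r'.updates = r.updates)
    (herrors : r'.numErrors R ≤ r.numErrors R + 1) :
    labelPotential R y₀ y (countUpdate (m + (m - 1) - 1) r') ≤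
      labelPotential R y₀ y (some r) + 5 := by
  have hvacant := vacantPotential_le R y₀ y
  have hcount (n : ℕ) : Rule.numErrors R { r' with updates := n } = r'.numErrors R := rfl
  unfold waitingTime at hvacant
  unfold countUpdate
  by_cases hy : R.target r.rep = y
  · split_ifs <;> simp only [labelPotential, rulePotential, hcount] <;>
      simp only [hrep, hy, if_true] <;> omega
  · split_ifs <;> simp only [labelPotential, rulePotential, hrep, hy, if_false] <;> omega

theorem rulePotential_new_le_of_target_eq (R : Representation X Y Φ m) (y₀ : Y) {x : X} {y : Y}
    (h : R.target x = y) : rulePotential R y₀ y ⟨x, ∅, 0⟩ ≤ m - 1 := by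
  have := Rule.numErrors_of_conj_eq_empty R (r := ⟨x, ∅, 0⟩) rfl
  simp only [rulePotential, h, if_true]
  omega

theorem rulePotential_new_le (R : Representation X Y Φ m) (y₀ y : Y) (x : X) :
    rulePotential R y₀ y ⟨x, ∅, 0⟩ ≤ vacantPotential R y₀ y + 2 * waitingTime m := by
  have := Rule.numErrors_of_conj_eq_empty R (r := ⟨x, ∅, 0⟩) rfl
  unfold rulePotential waitingTime
  split_ifs <;> simp only <;> omega

theorem potential_update (R : Representation X Y Φ m) (y₀ : Y) (L : Rules X Y) [DecidableEq Y]
    (y : Y) (o : Option (Rule X)) :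
    potential R y₀ (Function.update L y o) + labelPotential R y₀ y (L y) =
      potential R y₀ L + labelPotential R y₀ y o :=
  tsum_update_add_apply (fun y o => (labelPotential R y₀ y o : ℝ≥0∞)) L y o

open Classical in
theorem potential_empty_le (R : Representation X Y Φ m) (x₀ : X) (y₀ : Y) :
    potential R y₀ (fun _ => none) ≤
      (2 * m * (m - 1) : ℕ) + 6 * (if y₀ ≠ R.target x₀ then 1 else 0) := by
  have hm := R.size_pos x₀
  set s := (Finset.univ.image R.label).erase y₀ with hs
  have hpotential : potential R y₀ (fun _ => none) = (s.card * (waitingTime m + (m - 1)) : ℕ) := by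
    have hvacant (y : Y) :
        vacantPotential R y₀ y = if y ∈ s then waitingTime m + (m - 1) else 0 := by
      simp [vacantPotential, hs, and_comm]
    simp only [potential, labelPotential, hvacant, Nat.cast_ite, Nat.cast_zero]
    rw [tsum_eq_sum (s := s) fun y hy => if_neg hy, Finset.sum_ite_mem, Finset.inter_self,
      Finset.sum_const, nsmul_eq_mul, ← Nat.cast_mul]
  have himage : (Finset.univ.image R.label).card ≤ m := Finset.card_image_le.trans (by simp)
  rw [hpotential]
  split_ifs with h
  · have hcard : s.card ≤ m := (Finset.card_erase_le).trans himage
    have hbound : m * (waitingTime m + (m - 1)) ≤ 2 * m * (m - 1) + 6 := by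
      obtain rfl | hm1 : m = 1 ∨ 1 ≤ m - 1 := by omega
      · decide
      · rw [waitingTime, max_eq_left hm1]
        lia
    exact_mod_cast (Nat.mul_le_mul_right _ hcard).trans hbound
  · have hmem : y₀ ∈ Finset.univ.image R.label := by
      rw [not_not.1 h]
      exact Finset.mem_image_of_mem _ (Finset.mem_univ _)
    have hcard : s.card ≤ m - 1 := by
      rw [hs, Finset.card_erase_of_mem hmem]
      omega
    have hbound : (m - 1) * (waitingTime m + (m - 1)) ≤ 2 * m * (m - 1) := by
      rw [mul_comm (m - 1)]
      refine Nat.mul_le_mul_right _ ?_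
      unfold waitingTime
      omega
    simpa using (Nat.cast_le (α := ℝ≥0∞)).2 ((Nat.mul_le_mul_right _ hcard).trans hbound)

end Potential

section Update

variable {X Y : Type*} {Φ : Set (Feature X)} {m : ℕ} {ch : Choices X Y} {h : History X Y}
  {L : Rules X Y}

theorem matchedRule_eq_some {x : X} {y : Y} {r : Rule X}
    (hr : matchedRule ch h L x = some (y, r)) : L y = some r ∧ r.Sat x := by
  unfold matchedRule at hr
  split_ifs at hr with hex
  obtain ⟨r', hL, hsat⟩ := ch.rule_spec h L x hex
  simp only [hL, Option.map_some, Option.some.injEq, Prod.mk.injEq] at hr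
  obtain ⟨rfl, rfl⟩ := hr
  exact ⟨hL, hsat⟩

theorem not_sat_of_matchedRule_eq_none {x : X} (hr : matchedRule ch h L x = none) {y : Y}
    {r : Rule X} (hy : L y = some r) : ¬ r.Sat x := by
  intro hsat
  have hex : ∃ y r, L y = some r ∧ r.Sat x := ⟨y, r, hy, hsat⟩
  obtain ⟨r', hL, -⟩ := ch.rule_spec h L x hex
  simp [matchedRule, hex, hL] at hr

theorem predict_of_matchedRule_eq_some {x₀ x : X} {y₀ y : Y} {r : Rule X}
    (hr : matchedRule ch h L x = some (y, r)) : predict ch x₀ y₀ h L x = (y, r.rep) := by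
  simp only [predict, hr]

theorem predict_of_matchedRule_eq_none {x₀ x : X} {y₀ : Y} (hr : matchedRule ch h L x = none) :
    predict ch x₀ y₀ h L x = (y₀, x₀) := by
  simp only [predict, hr]

open Classical in
theorem one_add_potential_update_countUpdate_le (R : Representation X Y Φ m) (y₀ : Y) {y : Y}
    {r r' : Rule X} (hL : L y = some r) (hrep : r'.rep = r.rep) (hupdates : r'.updates = r.updates)
    (herrors : r'.numErrors R ≤ r.numErrors R + 1) {E : Prop}
    (hE : ¬ E → R.target r.rep = y → r'.numErrors R < r.numErrors R) :
    1 + potential R y₀ (Function.update L y (countUpdate (m + (m - 1) - 1) r')) ≤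
      potential R y₀ L + 6 * (if E then 1 else 0) := by
  set o := countUpdate (m + (m - 1) - 1) r'
  have hlabel : labelPotential R y₀ y o + 1 ≤
      labelPotential R y₀ y (some r) + 6 * (if E then 1 else 0) := by
    split_ifs with hexc
    · have hle : labelPotential R y₀ y o ≤ labelPotential R y₀ y (some r) + 5 :=
        labelPotential_countUpdate_le R y₀ y hrep hupdates herrors
      omega
    · exact labelPotential_countUpdate_lt R y₀ y hrep hupdates (hE hexc)
  have hlabel' : (labelPotential R y₀ y o + 1 : ℝ≥0∞) ≤
      labelPotential R y₀ y (some r) + 6 * (if E then 1 else 0) := by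
    exact_mod_cast hlabel
  have hupdate := potential_update R y₀ L y o
  rw [hL] at hupdate
  refine (ENNReal.add_le_add_iff_right
    (ENNReal.natCast_ne_top (labelPotential R y₀ y (some r)))).1 ?_
  calc 1 + potential R y₀ (Function.update L y o) + labelPotential R y₀ y (some r)
      = potential R y₀ L + (labelPotential R y₀ y o + 1) := by rw [add_assoc, hupdate]; ring
    _ ≤ potential R y₀ L + (labelPotential R y₀ y (some r) + 6 * (if E then 1 else 0)) := by
        gcongr
    _ = _ := by ring

open Classical in
theorem one_add_potential_updateRules_le_of_matched (R : Representation X Y Φ m) (y₀ : Y)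
    {ρ : Round X Y} {r : Rule X} (hr : matchedRule ch h L ρ.x = some (ρ.pred, r))
    (hexpl : ρ.expl = r.rep) (hρ : ρ.IsMistake) (b : Bool) :
    1 + potential R y₀ (updateRules m (m - 1) ch h L ρ.x ρ.y ρ.feature b) ≤
      potential R y₀ L + 6 * (if ρ.IsException R then 1 else 0) := by
  obtain ⟨hL, hsat⟩ := matchedRule_eq_some hr
  have hupdate : updateRules m (m - 1) ch h L ρ.x ρ.y ρ.feature b = Function.update L ρ.pred
      (countUpdate (m + (m - 1) - 1) (r.specialize ρ.feature ρ.x)) := by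
    simp only [updateRules, hr]
    rfl
  rw [hupdate]
  refine one_add_potential_update_countUpdate_le R y₀ hL (r.rep_specialize _ _)
    (r.updates_specialize _ _) (r.numErrors_specialize_le R _ _) fun hexc htarget => ?_
  obtain ⟨hy, hfeature⟩ : ρ.y = R.target ρ.x ∧ (R.label (R.comp ρ.x) ≠ R.label (R.comp r.rep) →
      ρ.feature = R.disc (R.comp ρ.x) (R.comp r.rep)) := by
    simpa [Round.IsException, hρ, hexpl] using hexc
  have hne : R.label (R.comp ρ.x) ≠ R.label (R.comp r.rep) := fun heq =>
    hρ (htarget.symm.trans (heq.symm.trans hy.symm))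
  rw [hfeature hne]
  exact Rule.numErrors_specialize_lt R hsat hne

open Classical in
theorem one_add_potential_updateRules_le_of_unmatched (R : Representation X Y Φ m)
    (hR : R.UniqueLabels) (y₀ : Y) {ρ : Round X Y} {r : Rule X}
    (hr : matchedRule ch h L ρ.x = none) (hL : L ρ.y = some r) (b : Bool) :
    1 + potential R y₀ (updateRules m (m - 1) ch h L ρ.x ρ.y ρ.feature b) ≤
      potential R y₀ L + 6 * (if ρ.IsException R then 1 else 0) := by
  obtain ⟨hmem, hfalse⟩ := ch.literal_spec h r ρ.x (not_sat_of_matchedRule_eq_none hr hL)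
  have hupdate : updateRules m (m - 1) ch h L ρ.x ρ.y ρ.feature b = Function.update L ρ.y
      (countUpdate (m + (m - 1) - 1) (r.generalize (ch.literal h r ρ.x))) := by
    simp only [updateRules, hr, hL]
    rfl
  rw [hupdate]
  refine one_add_potential_update_countUpdate_le R y₀ (r' := r.generalize (ch.literal h r ρ.x))
    hL rfl rfl (r.numErrors_generalize_le R _) fun hexc htarget => ?_
  have hy : ρ.y = R.target ρ.x := by_contra fun hne => hexc (Or.inl hne)
  exact Rule.numErrors_generalize_lt R hmem hfalse (hR (htarget.trans hy))

open Classical in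
theorem waitingTime_add_rulePotential_new_le (R : Representation X Y Φ m) {y₀ y : Y} (hy : y ≠ y₀)
    {x : X} {E : Prop} (hE : ¬ E → y = R.target x) :
    waitingTime m + rulePotential R y₀ y ⟨x, ∅, 0⟩ ≤
      vacantPotential R y₀ y + 6 * waitingTime m * (if E then 1 else 0) := by
  split_ifs with hexc
  · have := rulePotential_new_le R y₀ y x
    omega
  · have hvacant : vacantPotential R y₀ y = waitingTime m + (m - 1) :=
      if_pos ⟨⟨_, (hE hexc).symm⟩, hy⟩
    have := rulePotential_new_le_of_target_eq R y₀ (hE hexc).symm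
    omega

open Classical in
theorem one_add_potential_updateRules_le_of_vacant (R : Representation X Y Φ m) {y₀ : Y}
    {ρ : Round X Y} (hr : matchedRule ch h L ρ.x = none) (hL : L ρ.y = none) (hy : ρ.y ≠ y₀) :
    1 + ((waitingTime m : ℝ≥0∞)⁻¹ *
        potential R y₀ (updateRules m (m - 1) ch h L ρ.x ρ.y ρ.feature true) +
      (1 - (waitingTime m : ℝ≥0∞)⁻¹) *
        potential R y₀ (updateRules m (m - 1) ch h L ρ.x ρ.y ρ.feature false)) ≤
      potential R y₀ L + 6 * (if ρ.IsException R then 1 else 0) := by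
  simp only [updateRules, hr, hL, if_true, Bool.false_eq_true, if_false]
  have hupdate : potential R y₀ (Function.update L ρ.y (some ⟨ρ.x, ∅, 0⟩)) +
      vacantPotential R y₀ ρ.y = potential R y₀ L + rulePotential R y₀ ρ.y ⟨ρ.x, ∅, 0⟩ := by
    have h := potential_update R y₀ L ρ.y (some ⟨ρ.x, ∅, 0⟩)
    rwa [hL] at h
  have hnew : (waitingTime m + rulePotential R y₀ ρ.y ⟨ρ.x, ∅, 0⟩ : ℝ≥0∞) ≤
      vacantPotential R y₀ ρ.y + 6 * waitingTime m * (if ρ.IsException R then 1 else 0) := by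
    exact_mod_cast waitingTime_add_rulePotential_new_le R hy (x := ρ.x) (E := ρ.IsException R)
      fun hexc => by_contra fun hne => hexc (Or.inl hne)
  set V := potential R y₀ L
  set V' := potential R y₀ (Function.update L ρ.y (some ⟨ρ.x, ∅, 0⟩))
  set w : ℝ≥0∞ := (waitingTime m : ℝ≥0∞)
  set v : ℝ≥0∞ := (vacantPotential R y₀ ρ.y : ℝ≥0∞)
  set n : ℝ≥0∞ := (rulePotential R y₀ ρ.y ⟨ρ.x, ∅, 0⟩ : ℝ≥0∞)
  set e : ℝ≥0∞ := if ρ.IsException R then 1 else 0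
  have hw0 : w ≠ 0 := Nat.cast_ne_zero.2 (waitingTime_pos m).ne'
  have hw : w⁻¹ * w = 1 := ENNReal.inv_mul_cancel hw0 (ENNReal.natCast_ne_top _)
  have hp : w⁻¹ + (1 - w⁻¹) = 1 := add_tsub_cancel_of_le (inv_waitingTime_le_one m)
  have hfin : w⁻¹ * v ≠ ∞ :=
    ENNReal.mul_ne_top (ENNReal.inv_ne_top.2 hw0) (ENNReal.natCast_ne_top _)
  refine (ENNReal.add_le_add_iff_right hfin).1 ?_
  calc 1 + (w⁻¹ * V' + (1 - w⁻¹) * V) + w⁻¹ * v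
      = w⁻¹ * w + (w⁻¹ * (V' + v) + (1 - w⁻¹) * V) := by rw [hw]; ring
    _ = (w⁻¹ + (1 - w⁻¹)) * V + w⁻¹ * (w + n) := by rw [hupdate]; ring
    _ ≤ (w⁻¹ + (1 - w⁻¹)) * V + w⁻¹ * (v + 6 * w * e) := by gcongr
    _ = V + 6 * (w⁻¹ * w) * e + w⁻¹ * v := by rw [hp]; ring
    _ = V + 6 * e + w⁻¹ * v := by rw [hw, mul_one]

end Update

section Run

variable {X Y : Type*} {Φ : Set (Feature X)} {m : ℕ} (env : Environment X Y) (ch : Choices X Y)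

open Classical in
theorem mistake_add_potential_step_le (R : Representation X Y Φ m) (hR : R.UniqueLabels)
    (s : State X Y) (b : Bool) :
    (if (playRound env ch s b).IsMistake then 1 else 0) +
      ((waitingTime m : ℝ≥0∞)⁻¹ * potential R env.y₀ (step m (m - 1) env ch s true).rules +
        (1 - (waitingTime m : ℝ≥0∞)⁻¹) *
          potential R env.y₀ (step m (m - 1) env ch s false).rules) ≤
      potential R env.y₀ s.rules + 6 * (if (playRound env ch s b).IsException R then 1 else 0) := by
  have hp := inv_waitingTime_le_one m
  by_cases hmistake : (playRound env ch s b).IsMistake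
  swap
  · have hstep (b' : Bool) : (step m (m - 1) env ch s b').rules = s.rules := if_neg hmistake
    rw [if_neg hmistake, hstep, hstep]
    exact add_weighted_le hp (by simp) (by simp)
  have hstep (b' : Bool) : (step m (m - 1) env ch s b').rules =
      updateRules m (m - 1) ch s.history s.rules (playRound env ch s b).x (playRound env ch s b).y
        (playRound env ch s b).feature b' := if_pos hmistake
  rw [if_pos hmistake, hstep, hstep]
  rcases hmatched : matchedRule ch s.history s.rules (playRound env ch s b).x with _ | ⟨z, r⟩
  · have hpred : (playRound env ch s b).pred = env.y₀ :=
      congrArg Prod.fst (predict_of_matchedRule_eq_none hmatched)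
    rcases hL : s.rules (playRound env ch s b).y with _ | r
    · exact one_add_potential_updateRules_le_of_vacant R hmatched hL
        fun h => hmistake (hpred.trans h.symm)
    · exact add_weighted_le hp
        (one_add_potential_updateRules_le_of_unmatched R hR env.y₀ hmatched hL true)
        (one_add_potential_updateRules_le_of_unmatched R hR env.y₀ hmatched hL false)
  · obtain ⟨hpred, hexpl⟩ :
        (playRound env ch s b).pred = z ∧ (playRound env ch s b).expl = r.rep :=
      Prod.ext_iff.1 (predict_of_matchedRule_eq_some hmatched)
    rw [← hpred] at hmatched
    exact add_weighted_le hp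
      (one_add_potential_updateRules_le_of_matched R env.y₀ hmatched hexpl hmistake true)
      (one_add_potential_updateRules_le_of_matched R env.y₀ hmatched hexpl hmistake false)

theorem dependsOn_run (m l t : ℕ) :
    DependsOn (fun c => run m l env ch c t) (Finset.range t) := by
  intro c c' h
  induction t with
  | zero => rfl
  | succ t ih =>
    have hrun : run m l env ch c t = run m l env ch c' t := ih fun i hi => h i (by grind)
    simp only [run, hrun, h t (by simp)]

theorem dependsOn_roundAt (m l t : ℕ) :
    DependsOn (fun c => roundAt m l env ch c t) (Finset.range (t + 1)) := by
  intro c c' h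
  have hrun : run m l env ch c t = run m l env ch c' t :=
    dependsOn_run env ch m l t fun i hi => h i (by grind)
  simp only [roundAt, hrun, h t (by simp)]

variable {Ω : Type*} [MeasurableSpace Ω] {B : ℕ → Ω → Bool}

theorem measurable_comp_run (hB : ∀ t, Measurable (B t)) (m l t : ℕ) (f : State X Y → ℝ≥0∞) :
    Measurable fun ω => f (run m l env ch (fun i => B i ω) t) := by
  have hf : DependsOn (fun c => f (run m l env ch c t)) (Finset.range t) :=
    fun _ _ h => congrArg f (dependsOn_run env ch m l t h)
  exact (measurable_of_dependsOn hf).comp (measurable_pi_lambda _ hB)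

theorem measurable_comp_roundAt (hB : ∀ t, Measurable (B t)) (m l t : ℕ) (f : Round X Y → ℝ≥0∞) :
    Measurable fun ω => f (roundAt m l env ch (fun i => B i ω) t) := by
  have hf : DependsOn (fun c => f (roundAt m l env ch c t)) (Finset.range (t + 1)) :=
    fun _ _ h => congrArg f (dependsOn_roundAt env ch m l t h)
  exact (measurable_of_dependsOn hf).comp (measurable_pi_lambda _ hB)

variable {μ : Measure Ω}

open Classical in
theorem lintegral_numMistakes (hB : ∀ t, Measurable (B t)) (m l : ℕ) :
    ∫⁻ ω, numMistakes m l env ch (fun i => B i ω) ∂μ =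
      ∑' t, ∫⁻ ω, (if (roundAt m l env ch (fun i => B i ω) t).IsMistake then 1 else 0) ∂μ :=
  lintegral_tsum fun t =>
    (measurable_comp_roundAt env ch hB m l t fun ρ => if ρ.IsMistake then 1 else 0).aemeasurable

variable [IsProbabilityMeasure μ]

theorem lintegral_run_succ (hB : ∀ t, Measurable (B t)) (hindep : iIndepFun B μ) {p : ℝ≥0∞} {t : ℕ}
    (hp : μ {ω | B t ω = true} = p) (m l : ℕ) (f : State X Y → ℝ≥0∞) :
    ∫⁻ ω, f (run m l env ch (fun i => B i ω) (t + 1)) ∂μ =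
      ∫⁻ ω, (p * f (step m l env ch (run m l env ch (fun i => B i ω) t) true) +
        (1 - p) * f (step m l env ch (run m l env ch (fun i => B i ω) t) false)) ∂μ := by
  have htrue : μ (B t ⁻¹' {true}) = p := hp
  have hfalse : μ (B t ⁻¹' {false}) = 1 - p := by
    rw [← htrue, ← prob_compl_eq_one_sub (hB t (measurableSet_singleton true)),
      ← Set.preimage_compl, Bool.compl_singleton, Bool.not_true]
  have hdep (b : Bool) :
      DependsOn (fun c => f (step m l env ch (run m l env ch c t) b)) (Finset.range t) :=
    fun _ _ h => congrArg (fun s => f (step m l env ch s b)) (dependsOn_run env ch m l t h)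
  have hmeas (b : Bool) := measurable_comp_run env ch hB m l t fun s => f (step m l env ch s b)
  rw [lintegral_add_left ((hmeas true).const_mul p), lintegral_const_mul p (hmeas true),
    lintegral_const_mul (1 - p) (hmeas false)]
  refine (lintegral_eq_tsum_of_dependsOn hB hindep (i := t) (by simp) hdep).trans ?_
  rw [tsum_bool, htrue, hfalse, add_comm]

open Classical in
theorem lintegral_mistake_add_potential_le (R : Representation X Y Φ m) (hR : R.UniqueLabels)
    (hB : ∀ t, Measurable (B t)) (hindep : iIndepFun B μ) {t : ℕ}
    (hp : μ {ω | B t ω = true} = (waitingTime m : ℝ≥0∞)⁻¹) :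
    ∫⁻ ω, (if (roundAt m (m - 1) env ch (fun i => B i ω) t).IsMistake then 1 else 0) ∂μ +
        ∫⁻ ω, potential R env.y₀ (run m (m - 1) env ch (fun i => B i ω) (t + 1)).rules ∂μ ≤
      ∫⁻ ω, potential R env.y₀ (run m (m - 1) env ch (fun i => B i ω) t).rules ∂μ +
        6 * ∫⁻ ω, (if (roundAt m (m - 1) env ch (fun i => B i ω) t).IsException R
          then 1 else 0) ∂μ := by
  have hround := measurable_comp_roundAt env ch hB m (m - 1) t
  rw [lintegral_run_succ env ch hB hindep hp m (m - 1) fun s => potential R env.y₀ s.rules,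
    ← lintegral_add_left (hround fun ρ => if ρ.IsMistake then 1 else 0),
    ← lintegral_const_mul 6 (hround fun ρ => if ρ.IsException R then 1 else 0),
    ← lintegral_add_left
      (measurable_comp_run env ch hB m (m - 1) t fun s => potential R env.y₀ s.rules)]
  exact lintegral_mono fun ω => mistake_add_potential_step_le env ch R hR _ _

open Classical in
theorem lintegral_numExceptions {m' : ℕ} (R : Representation X Y Φ m')
    (hB : ∀ t, Measurable (B t)) (m l : ℕ) :
    ∫⁻ ω, numExceptions R m l env ch (fun i => B i ω) ∂μ =
      (if env.y₀ ≠ R.target env.x₀ then 1 else 0) +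
        ∑' t, ∫⁻ ω, (if (roundAt m l env ch (fun i => B i ω) t).IsException R
          then 1 else 0) ∂μ := by
  simp only [numExceptions]
  rw [lintegral_add_left measurable_const, lintegral_const, measure_univ, mul_one,
    lintegral_tsum fun t => (measurable_comp_roundAt env ch hB m l t
      fun ρ => if ρ.IsException R then 1 else 0).aemeasurable]

end Run

end DFF

theorem mainTheorem5_general {X Y Ω : Type*} {Φ : Set (DFF.Feature X)} {m : ℕ}
    (R : DFF.Representation X Y Φ m) (hR : R.UniqueLabels)
    (env : DFF.Environment X Y) (ch : DFF.Choices X Y)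
    [MeasurableSpace Ω] (μ : Measure Ω) [IsProbabilityMeasure μ]
    (B : ℕ → Ω → Bool) (hB : ∀ t, Measurable (B t)) (hindep : iIndepFun B μ)
    (hp : ∀ t, μ {ω | B t ω = true} =
      ENNReal.ofReal (if m = 1 then 1 else 1 / ((m : ℝ) - 1))) :
    ∫⁻ ω, DFF.numMistakes m (m - 1) env ch (fun t => B t ω) ∂μ
      ≤ 2 * m * (m - 1 : ℕ) +
        6 * ∫⁻ ω, DFF.numExceptions R m (m - 1) env ch (fun t => B t ω) ∂μ := by
  classical
  simp only [DFF.ofReal_creationProb (R.size_pos env.x₀)] at hp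
  rw [DFF.lintegral_numMistakes env ch hB, DFF.lintegral_numExceptions env ch R hB, mul_add,
    ← add_assoc, ← ENNReal.tsum_mul_left]
  refine (DFF.tsum_le_add_tsum_of_add_le_add (v := fun t =>
    ∫⁻ ω, DFF.potential R env.y₀ (DFF.run m (m - 1) env ch (fun i => B i ω) t).rules ∂μ) fun t =>
    DFF.lintegral_mistake_add_potential_le env ch R hR hB hindep (hp t)).trans ?_
  gcongr
  simpa [DFF.run] using DFF.potential_empty_le R env.x₀ env.y₀

theorem mainTheorem5 {X Y Ω : Type*} [Finite Y]
    (Φ : Set (DFF.Feature X)) (hΦ : ∀ φ ∈ Φ, DFF.neg φ ∈ Φ)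
    (m k : ℕ) (R : DFF.Representation X Y Φ m) (hR : R.UniqueLabels)
    (env : DFF.Environment X Y) (ch : DFF.Choices X Y)
    [MeasurableSpace Ω] (μ : Measure Ω) [IsProbabilityMeasure μ]
    (B : ℕ → Ω → Bool) (hB : ∀ t, Measurable (B t)) (hindep : iIndepFun B μ)
    (hp : ∀ t, μ {ω | B t ω = true} =
      ENNReal.ofReal (if m = 1 then 1 else 1 / ((m : ℝ) - 1)))
    (hk : ∀ᵐ ω ∂μ, DFF.numExceptions R m (m - 1) env ch (fun t => B t ω) ≤ k) :
    ∫⁻ ω, DFF.numMistakes m (m - 1) env ch (fun t => B t ω) ∂μ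
      ≤ ENNReal.ofReal (2 * m * ((m : ℝ) - 1) + 6 * k) := by
  have hm : 0 < m := R.size_pos env.x₀
  have hexc : ∫⁻ ω, DFF.numExceptions R m (m - 1) env ch (fun t => B t ω) ∂μ ≤ k := by
    simpa using lintegral_mono_ae hk
  calc ∫⁻ ω, DFF.numMistakes m (m - 1) env ch (fun t => B t ω) ∂μ
      ≤ 2 * m * (m - 1 : ℕ) + 6 * k :=
        (mainTheorem5_general R hR env ch μ B hB hindep hp).trans (by gcongr)
    _ = ((2 * m * (m - 1) + 6 * k : ℕ) : ℝ≥0∞) := by push_cast; rfl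
    _ = ENNReal.ofReal (2 * m * ((m : ℝ) - 1) + 6 * k) := by
        rw [← ENNReal.ofReal_natCast]
        push_cast [hm]
        rfl
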